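/- **Setting.** Let $\mathcal I,\mathcal J,\mathcal T$ be finite sets (EVs, charging spots, time periods), with data $v_i,e_i,\pi(t),G_j(t)\in\mathbb R$ and $s_i(t)\in\{0,1\}$ (valuation, energy request, unit energy cost, capacity, parking indicator). For $z=(x,p,\phi,\psi,\zeta,\xi)\in\mathbb R^N$, with blocks indexed by $\mathcal I\times\mathcal J$, $\mathcal J\times\mathcal T$, $\mathcal I\times\mathcal J$, $\mathcal J\times\mathcal T$, $\mathcal J\times\mathcal T$, $\mathcal I$, let $f(z)=\sum_{i,j}v_ix_{ij}-\sum_t\pi(t)\sum_jp_j(t)$, and consider the linear constraints $$\sum_t s_i(t)p_j(t)-e_ix_{ij}=\phi_{ij},\quad 1-\sum_i s_i(t)x_{ij}=\psi_{jt},\quad G_j(t)-p_j(t)=\zeta_{jt},\quad 1-\sum_jx_{ij}=\xi_i\qquad(L)$$ for all $i,j,t$. Write them as $(h^1_{ij})^\top z=0$, $(h^2_{jt})^\top z=1$, $(h^3_{jt})^\top z=G_j(t)$, $(h^4_i)^\top z=1$, where $h^1_{ij}$ has entries $-e_i$ at $x_{ij}$, $s_i(t)$ at $p_j(t)$, $-1$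 at $\phi_{ij}$; $h^2_{jt}$ has entries $s_i(t)$ at $x_{ij}$, $1$ at $\psi_{jt}$; $h^3_{jt}$ has entries $1$ at $p_j(t)$ and $\zeta_{jt}$; $h^4_i$ has entries $1$ at $x_{ij}$ (all $j$) and $\xi_i$. *(MILP)*: maximize $f(z)$ subject to $(L)$, $x_{ij}\in\{0,1\}$, $z\ge0$. *(CPP)*: maximize $f(z)$ over $z\in\mathbb R^N$, $Z\in\mathbb R^{N\times N}$ subject to $(L)$, $\mathrm{Tr}(h^1_{ij}(h^1_{ij})^\top Z)=0$, $\mathrm{Tr}(h^2_{jt}(h^2_{jt})^\top Z)=1$, $\mathrm{Tr}(h^3_{jt}(h^3_{jt})^\top Z)=G_j(t)^2$, $\mathrm{Tr}(h^4_i(h^4_i)^\top Z)=1$, $x_{ij}=Z_{x_{ij},x_{ij}}$, and $\begin{bmatrix}1&z^\top\\z&Z\end{bmatrix}$ completely positive, i.e. a finite sum of matrices $ww^\top$ with $w\ge0$. *(COP)*, its copositive dual: for $h\in\mathbb R^N$ let $H(h)=\begin{bmatrix}0&\frac12h^\top\\\frac12h&0\end{bmatrix}$, $\tilde H(h)=\begin{bmatrix}0&0\\0&hh^\top\end{bmatrix}$;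 let $B_{ij}=H(\mathbf e_{x_{ij}})-\tilde H(\mathbf e_{x_{ij}})$ and let $q$ be the vector with $f(z)=q^\top z$. Minimize $$\sum_{j,t}\bigl(\lambda^2_{jt}+\Lambda^2_{jt}+G_j(t)\lambda^3_{jt}+G_j(t)^2\Lambda^3_{jt}\bigr)+\sum_i(\lambda^4_i+\Lambda^4_i)$$ over real multipliers $\lambda,\Lambda,\delta$ and symmetric copositive $\Omega\in\mathbb R^{(N+1)\times(N+1)}$ (i.e. $y^\top\Omega y\ge0$ for all $y\ge0$) with $$\begin{aligned}H(q)&-\sum_{i,j}\bigl(\lambda^1_{ij}H(h^1_{ij})+\Lambda^1_{ij}\tilde H(h^1_{ij})\bigr)-\sum_{k=2,3}\sum_{j,t}\bigl(\lambda^k_{jt}H(h^k_{jt})+\Lambda^k_{jt}\tilde H(h^k_{jt})\bigr)\\&-\sum_i\bigl(\lambda^4_iH(h^4_i)+\Lambda^4_i\tilde H(h^4_i)\bigr)-\sum_{i,j}\delta_{ij}B_{ij}+\Omega=0.\end{aligned}$$ *Strong duality* means that (CPP) and (COP) have the same finite optimal value. **Mechanism.** Let $z^*$ be an optimal solution of (MILP)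 and $(\lambda^*,\Lambda^*)$ part of an optimal solution of (COP). At the assignment profile $x=(x_i,x_{-i})$, copositive marginal pricing (CMP) charges user $i$ $$\begin{aligned}\rho_i(x_i,x_{-i})=\sum_{j,t}\Bigl[&\pi(t)p^*_j(t)+\bigl(\lambda^{3,*}_{jt}+G_j(t)\Lambda^{3,*}_{jt}\bigr)p^*_j(t)\\&+\lambda^{2,*}_{jt}+\Lambda^{2,*}_{jt}\Bigl(1+2\sum_{l\ne i}s_l(t)x_{lj}+2\psi^*_{jt}\Bigr)\Bigr]s_i(t)x_{ij}.\end{aligned}$$ The *options* of user $i$ are the $x_i\in\{0,1\}^{\mathcal J}$ for which $\phi_{ij}:=\sum_ts_i(t)p^*_j(t)-e_ix_{ij}\ge0$ for all $j$ and $\xi_i:=1-\sum_jx_{ij}\ge0$; the welfare of user $i$ is $\sum_jv_ix_{ij}-\rho_i(x_i,x_{-i})$. **Theorem (individual rationality).** If strong duality holds, then for every such $z^*$ and $(\lambda^*,\Lambda^*)$: 1. every user has nonnegative welfare at the central assignment: $\sum_jv_ix^*_{ij}-\rho_i(x^*_i,x^*_{-i})\ge0$ for all $i$; 2. for every user $i$,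 $(x^*_i,\phi^*_i,\xi^*_i)$ is feasible and optimal for the problem of maximizing $\sum_jv_ix_{ij}-\rho_i(x_i,x^*_{-i})$ over all options $x_i$ (with their $\phi_i,\xi_i$); that is, $x^*$ is a Nash equilibrium of the game in which each user chooses an option and receives the welfare above. -/

import Mathlib

open Matrix

namespace EVCharging

/-! ### The cones -/

/-- The cone of completely positive matrices: finite sums of `w wᵀ` with `w` entrywise nonnegative. -/
def CompletelyPositive {n : Type*} (X : Matrix n n ℝ) : Prop :=
  ∃ (k : ℕ) (w : Fin k → n → ℝ), (∀ m a, 0 ≤ w m a) ∧ X = ∑ m, vecMulVec (w m) (w m)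

/-- The cone of (symmetric) copositive matrices. -/
def Copositive {n : Type*} [Fintype n] (W : Matrix n n ℝ) : Prop :=
  W.IsSymm ∧ ∀ y : n → ℝ, (∀ a, 0 ≤ y a) → 0 ≤ y ⬝ᵥ (W *ᵥ y)

/-! ### The charging problem -/

/-- The data of a charging station with EVs `I`, charging spots `J` and time periods `T`:
valuations `v i`, energy requests `e i`, parking indicators `s i t`, unit energy costs `cost t`
and capacities `G j t`. Arrival and departure times enter only through `s`. -/
structure Station (I J T : Type*) where
  v : I → ℝ
  e : I → ℝ
  s : I → T → ℝ
  s_binary : ∀ i t, s i t = 0 ∨ s i t = 1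
  cost : T → ℝ
  G : J → T → ℝ

/-- The positions of the coordinates of `z = (x, p, φ, ψ, ζ, ξ)`. -/
inductive Var (I J T : Type*)
  | x (i : I) (j : J)
  | p (j : J) (t : T)
  | phi (i : I) (j : J)
  | psi (j : J) (t : T)
  | zeta (j : J) (t : T)
  | xi (i : I)
  deriving DecidableEq, Fintype

section

variable {I J T : Type*} [Fintype I] [Fintype J] [Fintype T]

/-- The social welfare `∑ v_i x_ij - ∑ π(t) p_j(t)`. -/
def objective (D : Station I J T) (z : Var I J T → ℝ) : ℝ :=
  ∑ i, ∑ j, D.v i * z (.x i j) - ∑ t, D.cost t * ∑ j, z (.p j t)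

/-- The linear equality constraints shared by the MILP and its completely positive reformulation. -/
structure LinearConstraints (D : Station I J T) (z : Var I J T → ℝ) : Prop where
  energy : ∀ i j, ∑ t, D.s i t * z (.p j t) - D.e i * z (.x i j) = z (.phi i j)
  occupancy : ∀ j t, 1 - ∑ i, D.s i t * z (.x i j) = z (.psi j t)
  capacity : ∀ j t, D.G j t - z (.p j t) = z (.zeta j t)
  unique : ∀ i, 1 - ∑ j, z (.x i j) = z (.xi i)

/-- Feasible points of the MILP in standard form. -/
structure MILPFeasible (D : Station I J T) (z : Var I J T → ℝ) : Prop where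
  linear : LinearConstraints D z
  binary : ∀ i j, z (.x i j) = 0 ∨ z (.x i j) = 1
  nonneg : ∀ a, 0 ≤ z a

/-- Optimal solutions of the MILP. -/
def MILPOptimal (D : Station I J T) (z : Var I J T → ℝ) : Prop :=
  MILPFeasible D z ∧ ∀ z', MILPFeasible D z' → objective D z' ≤ objective D z

variable [DecidableEq I] [DecidableEq J] [DecidableEq T]

/-! ### Coefficient vectors of the linear constraints and of the objective -/

/-- The standard basis vector at a position. -/
def basisVec (a : Var I J T) : Var I J T → ℝ := Pi.single a 1

/-- Energy delivery: `∑ₜ s_i(t) p_j(t) - e_i x_ij - φ_ij = 0`. -/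
def h1 (D : Station I J T) (i : I) (j : J) : Var I J T → ℝ :=
  -(D.e i • basisVec (.x i j)) + ∑ t, D.s i t • basisVec (.p j t) - basisVec (.phi i j)

/-- Occupancy: `∑ᵢ s_i(t) x_ij + ψ_jt = 1`. -/
def h2 (D : Station I J T) (j : J) (t : T) : Var I J T → ℝ :=
  ∑ i, D.s i t • basisVec (.x i j) + basisVec (.psi j t)

/-- Capacity: `p_j(t) + ζ_jt = G_j(t)`. -/
def h3 (j : J) (t : T) : Var I J T → ℝ :=
  basisVec (.p j t) + basisVec (.zeta j t)

/-- At most one spot: `∑ⱼ x_ij + ξ_i = 1`. -/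
def h4 (i : I) : Var I J T → ℝ :=
  ∑ j, basisVec (.x i j) + basisVec (.xi i)

/-- The coefficient vector of the (maximized) objective. -/
def objVec (D : Station I J T) : Var I J T → ℝ :=
  ∑ i, ∑ j, D.v i • basisVec (.x i j) - ∑ t, ∑ j, D.cost t • basisVec (.p j t)

/-! ### The completely positive program -/

/-- The matrix `[1, zᵀ; z, Z]`. -/
def bordered (z : Var I J T → ℝ) (Z : Matrix (Var I J T) (Var I J T) ℝ) :
    Matrix (Unit ⊕ Var I J T) (Unit ⊕ Var I J T) ℝ :=
  fromBlocks 1 (replicateRow Unit z) (replicateCol Unit z) Z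

/-- Feasible points of the completely positive program. -/
structure CPPFeasible (D : Station I J T) (z : Var I J T → ℝ)
    (Z : Matrix (Var I J T) (Var I J T) ℝ) : Prop where
  linear : LinearConstraints D z
  trace1 : ∀ i j, (vecMulVec (h1 D i j) (h1 D i j) * Z).trace = 0
  trace2 : ∀ j t, (vecMulVec (h2 D j t) (h2 D j t) * Z).trace = 1
  trace3 : ∀ j t, (vecMulVec (h3 j t) (h3 j t) * Z).trace = D.G j t ^ 2
  trace4 : ∀ i, (vecMulVec (h4 i) (h4 i) * Z).trace = 1
  binary : ∀ i j, z (.x i j) = Z (.x i j) (.x i j)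
  cone : CompletelyPositive (bordered z Z)

/-- The set of objective values of the completely positive program (a maximization). -/
def CPPValues (D : Station I J T) : Set ℝ :=
  {r | ∃ z Z, CPPFeasible D z Z ∧ r = objective D z}

/-! ### The dual copositive program -/

/-- The matrix with `Tr (linMat h * [1, zᵀ; z, Z]) = hᵀ z`. -/
noncomputable def linMat (h : Var I J T → ℝ) :
    Matrix (Unit ⊕ Var I J T) (Unit ⊕ Var I J T) ℝ :=
  fromBlocks 0 (replicateRow Unit ((1 / 2 : ℝ) • h)) (replicateCol Unit ((1 / 2 : ℝ) • h)) 0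

/-- The matrix with `Tr (sqMat h * [1, zᵀ; z, Z]) = hᵀ Z h`. -/
def sqMat (h : Var I J T → ℝ) : Matrix (Unit ⊕ Var I J T) (Unit ⊕ Var I J T) ℝ :=
  fromBlocks 0 0 0 (vecMulVec h h)

/-- The matrix with `Tr (binMat i j * [1, zᵀ; z, Z]) = x_ij - Z_{x_ij, x_ij}`. -/
noncomputable def binMat (i : I) (j : J) :
    Matrix (Unit ⊕ Var I J T) (Unit ⊕ Var I J T) ℝ :=
  linMat (basisVec (.x i j)) - sqMat (basisVec (.x i j))

end

/-- The variables of the dual: `lam1, …, lam4` for the linear constraints, `Lam1, …, Lam4` for the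
trace constraints, `delta` for the binary constraints and `Omega` for the cone constraint. -/
structure DualVars (I J T : Type*) where
  lam1 : I → J → ℝ
  lam2 : J → T → ℝ
  lam3 : J → T → ℝ
  lam4 : I → ℝ
  Lam1 : I → J → ℝ
  Lam2 : J → T → ℝ
  Lam3 : J → T → ℝ
  Lam4 : I → ℝ
  delta : I → J → ℝ
  Omega : Matrix (Unit ⊕ Var I J T) (Unit ⊕ Var I J T) ℝ

section

variable {I J T : Type*} [Fintype I] [Fintype J] [Fintype T]

/-- The objective of the copositive program (a minimization). -/
def copObjective (D : Station I J T) (d : DualVars I J T) : ℝ :=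
  ∑ j, ∑ t, (d.lam2 j t + d.Lam2 j t + D.G j t * d.lam3 j t + D.G j t ^ 2 * d.Lam3 j t)
    + ∑ i, (d.lam4 i + d.Lam4 i)

variable [DecidableEq I] [DecidableEq J] [DecidableEq T]

/-- Feasible points of the copositive program. -/
structure COPFeasible (D : Station I J T) (d : DualVars I J T) : Prop where
  stationarity :
    linMat (objVec D)
      - ∑ i, ∑ j, (d.lam1 i j • linMat (h1 D i j) + d.Lam1 i j • sqMat (h1 D i j))
      - ∑ j, ∑ t, (d.lam2 j t • linMat (h2 D j t) + d.Lam2 j t • sqMat (h2 D j t))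
      - ∑ j, ∑ t, (d.lam3 j t • linMat (h3 j t) + d.Lam3 j t • sqMat (h3 j t))
      - ∑ i, (d.lam4 i • linMat (h4 i) + d.Lam4 i • sqMat (h4 i))
      - ∑ i, ∑ j, d.delta i j • binMat i j
      + d.Omega = 0
  cone : Copositive d.Omega

/-- Optimal solutions of the copositive program. -/
def COPOptimal (D : Station I J T) (d : DualVars I J T) : Prop :=
  COPFeasible D d ∧ ∀ d', COPFeasible D d' → copObjective D d ≤ copObjective D d'

/-- The set of objective values of the copositive program. -/
def COPValues (D : Station I J T) : Set ℝ :=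
  {r | ∃ d, COPFeasible D d ∧ r = copObjective D d}

/-- Strong duality: the two programs have the same finite optimal value. -/
def StrongDuality (D : Station I J T) : Prop :=
  ∃ r : ℝ, IsLUB (CPPValues D) r ∧ IsGLB (COPValues D) r

end

/-! ### The copositive marginal pricing mechanism -/

section

variable {I J T : Type*} [Fintype I] [Fintype J] [Fintype T]

/-- The assignment part `x` of `z`. -/
def assignment (z : Var I J T → ℝ) : I → J → ℝ := fun i j => z (.x i j)

/-- The payment for energy of user `i` at the assignment profile `x`, given the central `z`. -/
def paymentEnergy (D : Station I J T) (z : Var I J T → ℝ) (i : I) (x : I → J → ℝ) : ℝ :=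
  ∑ j, ∑ t, D.cost t * z (.p j t) * D.s i t * x i j

/-- The shadow-price payment for the capacity limits. -/
def paymentCapacity (D : Station I J T) (z : Var I J T → ℝ) (d : DualVars I J T)
    (i : I) (x : I → J → ℝ) : ℝ :=
  ∑ j, ∑ t, (d.lam3 j t + D.G j t * d.Lam3 j t) * z (.p j t) * D.s i t * x i j

variable [DecidableEq I]

/-- The congestion charge. -/
def paymentCongestion (D : Station I J T) (z : Var I J T → ℝ) (d : DualVars I J T)
    (i : I) (x : I → J → ℝ) : ℝ :=
  ∑ j, ∑ t, (d.lam2 j t + d.Lam2 j t *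
      (1 + 2 * ∑ l ∈ Finset.univ.erase i, D.s l t * x l j + 2 * z (.psi j t))) * D.s i t * x i j

/-- The payment `ρ_i(x_i, x_{-i})`. -/
def payment (D : Station I J T) (z : Var I J T → ℝ) (d : DualVars I J T)
    (i : I) (x : I → J → ℝ) : ℝ :=
  paymentEnergy D z i x + paymentCapacity D z d i x + paymentCongestion D z d i x

/-- The welfare `∑ⱼ v_i x_ij - ρ_i(x_i, x_{-i})` of user `i` at the assignment profile `x`. -/
def welfare (D : Station I J T) (z : Var I J T → ℝ) (d : DualVars I J T)
    (i : I) (x : I → J → ℝ) : ℝ :=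
  ∑ j, D.v i * x i j - payment D z d i x

/-- Feasible points `(x_i, φ_i, ξ_i)` of the subproblem of user `i`, the power profile being that
of the central `z`. -/
structure UserFeasible (D : Station I J T) (z : Var I J T → ℝ) (i : I)
    (xi phii : J → ℝ) (xii : ℝ) : Prop where
  energy : ∀ j, ∑ t, D.s i t * z (.p j t) - D.e i * xi j = phii j
  unique : 1 - ∑ j, xi j = xii
  binary : ∀ j, xi j = 0 ∨ xi j = 1
  x_nonneg : ∀ j, 0 ≤ xi j
  phi_nonneg : ∀ j, 0 ≤ phii j
  xi_nonneg : 0 ≤ xii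

/-- The welfare of user `i` for the choice `x_i` while all others keep their central assignment. -/
def deviationWelfare (D : Station I J T) (z : Var I J T → ℝ) (d : DualVars I J T)
    (i : I) (xi : J → ℝ) : ℝ :=
  welfare D z d i (Function.update (assignment z) i xi)

/-- Optimal solutions `(x_i, φ_i, ξ_i)` of the subproblem of user `i`. -/
def UserOptimal (D : Station I J T) (z : Var I J T → ℝ) (d : DualVars I J T) (i : I)
    (xi phii : J → ℝ) (xii : ℝ) : Prop :=
  UserFeasible D z i xi phii xii ∧
    ∀ xi' phii' xii', UserFeasible D z i xi' phii' xii' →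
      deviationWelfare D z d i xi' ≤ deviationWelfare D z d i xi

/-- The options of user `i` in the choice game. -/
def userOptions (D : Station I J T) (z : Var I J T → ℝ) (i : I) : Set (J → ℝ) :=
  {xi | ∃ phii xii, UserFeasible D z i xi phii xii}

end

/-- Pure Nash equilibrium of a game with option sets `A i` and payoffs `u i`. -/
def IsNashEquilibrium {I S : Type*} [DecidableEq I] (A : I → Set S) (u : I → (I → S) → ℝ)
    (x : I → S) : Prop :=
  ∀ i, x i ∈ A i ∧ ∀ y ∈ A i, u i (Function.update x i y) ≤ u i x

end EVCharging

set_option linter.unusedSectionVars false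

/-! A unilateral deviation is tested against the copositive form of the dual slack `Omega`. Each
summand `w wᵀ` of a completely positive `[1, zᵀ; z, Z]` either has border entry `0` and contributes
nothing to `z`, or rescales to a feasible point of the MILP; hence the completely positive program
has the value of the MILP (`CPPFeasible.objective_le`). With strong duality, `(1, z*)` is then a
zero of the form of `Omega`. So is `(1, 0)`, since the corner entry of `Omega` vanishes. The
first-order conditions at these two zeros (`border_slackness`) give `Lam3 = 0` and `cost + lam3 ≥ 0`
wherever power is delivered (`capacity_price`).

Now let user `i` switch. The point `deviate` drops the power of `i` at the spot left, freezes `ψ`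
and `ζ`, and lets `φ` and `ξ` absorb the change. It is nonnegative but may violate the occupancy and
capacity equations. Copositivity there bounds the change of social welfare by the dual price of
these violations (`deviation_gain_le`). While `i` is parked, joining a spot moves its occupancy row
from 1 to 2 at price `lam2 + 3 * Lam2`, and leaving moves it from 1 to 0 at price `-(lam2 + Lam2)`:
exactly the changes of the congestion charge. So no switch pays (`deviationWelfare_le`). Individual
rationality is the comparison with not charging, whose welfare is 0. -/

namespace EVCharging

section

variable {I J T : Type*} [Fintype I] [Fintype J] [Fintype T]

/-! ### Copositive matrices -/

/-- A zero `w ≥ 0` of a copositive quadratic form satisfies the first-order conditions. -/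
theorem Copositive.mulVec_nonneg {n : Type*} [Fintype n] [DecidableEq n] {W : Matrix n n ℝ}
    (hW : Copositive W) {w : n → ℝ} (hw : ∀ a, 0 ≤ w a) (h0 : w ⬝ᵥ (W *ᵥ w) = 0) (a : n) :
    0 ≤ (W *ᵥ w) a := by
  by_contra! hneg
  -- The form at `w + ε e_a`; its constant term is zero by `h0`.
  have key : ∀ ε : ℝ, 0 ≤ ε → 0 ≤ 2 * ε * (W *ᵥ w) a + ε ^ 2 * W a a := by
    intro ε hε
    have h := hW.2 (w + ε • Pi.single a 1) (fun b => by
      have : 0 ≤ (Pi.single a 1 : n → ℝ) b := by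
        rw [Pi.single_apply]; split_ifs <;> norm_num
      simpa using add_nonneg (hw b) (mul_nonneg hε this))
    have hs : w ⬝ᵥ (W *ᵥ Pi.single a 1) = (W *ᵥ w) a := by
      rw [dotProduct_mulVec, ← mulVec_transpose, hW.1.eq]; simp
    have hd : (Pi.single a 1 : n → ℝ) ⬝ᵥ (W *ᵥ Pi.single a 1) = W a a := by simp
    have he : (Pi.single a 1 : n → ℝ) ⬝ᵥ (W *ᵥ w) = (W *ᵥ w) a := by simp
    rw [mulVec_add, mulVec_smul, dotProduct_add, add_dotProduct, add_dotProduct, smul_dotProduct,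
      smul_dotProduct, dotProduct_smul, dotProduct_smul, h0, hs, he, hd] at h
    simp only [smul_eq_mul] at h
    nlinarith
  set g := (W *ᵥ w) a
  -- For this `ε` one has `ε * |W a a| < -g`, so the negative linear term wins; the `+ 1` covers `W
  -- a a = 0`.
  have h1 := key (-g / (|W a a| + 1)) (by apply div_nonneg <;> [linarith; positivity])
  have hpos : 0 < |W a a| + 1 := by positivity
  have h2 : -g / (|W a a| + 1) * (|W a a| + 1) = -g := div_mul_cancel₀ _ hpos.ne'
  set ε := -g / (|W a a| + 1)
  have hε : 0 < ε := div_pos (by linarith) hpos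
  have h3 : W a a ≤ |W a a| := le_abs_self _
  have h4 : 0 ≤ ε * (2 * g + ε * W a a) := by nlinarith
  have h5 : 0 ≤ 2 * g + ε * W a a := nonneg_of_mul_nonneg_right h4 hε
  nlinarith [mul_le_mul_of_nonneg_left h3 hε.le]

/-- Complementary slackness at a zero of a copositive quadratic form. -/
theorem Copositive.mul_mulVec_eq_zero {n : Type*} [Fintype n] [DecidableEq n] {W : Matrix n n ℝ}
    (hW : Copositive W) {w : n → ℝ} (hw : ∀ a, 0 ≤ w a) (h0 : w ⬝ᵥ (W *ᵥ w) = 0) (a : n) :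
    w a * (W *ᵥ w) a = 0 :=
  (Finset.sum_eq_zero_iff_of_nonneg fun b _ =>
    mul_nonneg (hw b) (hW.mulVec_nonneg hw h0 b)).1 h0 a (Finset.mem_univ a)

/-! ### Homogenized vectors -/

/-- The vector `(c, z)`. -/
def homog (c : ℝ) (z : Var I J T → ℝ) : Unit ⊕ Var I J T → ℝ := Sum.elim (fun _ => c) z

theorem homog_nonneg {c : ℝ} {z : Var I J T → ℝ} (hc : 0 ≤ c) (hz : ∀ a, 0 ≤ z a) (a) :
    0 ≤ homog c z a := by
  rcases a with _ | a
  · exact hc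
  · exact hz a

theorem homog_sqMat (h z z' : Var I J T → ℝ) (c c' : ℝ) :
    homog c z ⬝ᵥ (sqMat h *ᵥ homog c' z') = (h ⬝ᵥ z) * (h ⬝ᵥ z') := by
  simp only [homog, sqMat, fromBlocks_mulVec, Sum.elim_comp_inl, Sum.elim_comp_inr,
    zero_mulVec, zero_add, add_zero, sumElim_dotProduct_sumElim, vecMulVec_mulVec]
  rw [dotProduct_comm z]
  simp [smul_dotProduct, mul_comm]

/-- `M ↦ yᵀ M y'`. -/
noncomputable def evalForm {n : Type*} [Fintype n] (y y' : n → ℝ) : Matrix n n ℝ →ₗ[ℝ] ℝ where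
  toFun M := y ⬝ᵥ (M *ᵥ y')
  map_add' M N := by rw [add_mulVec, dotProduct_add]
  map_smul' c M := by rw [smul_mulVec, dotProduct_smul, RingHom.id_apply]

theorem trace_vecMulVec_mul (h : Var I J T → ℝ) (Z : Matrix (Var I J T) (Var I J T) ℝ) :
    (vecMulVec h h * Z).trace = h ⬝ᵥ (Z *ᵥ h) := by
  rw [trace_mul_comm, mul_vecMulVec, trace_vecMulVec, dotProduct_comm]

variable [DecidableEq I] [DecidableEq J] [DecidableEq T]

/-! ### Linear forms -/

theorem basisVec_dotProduct (a : Var I J T) (z : Var I J T → ℝ) : basisVec a ⬝ᵥ z = z a := by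
  simp [basisVec]

theorem h1_dotProduct (D : Station I J T) (i : I) (j : J) (z : Var I J T → ℝ) :
    h1 D i j ⬝ᵥ z = ∑ t, D.s i t * z (.p j t) - D.e i * z (.x i j) - z (.phi i j) := by
  simp only [h1, sub_dotProduct, add_dotProduct, neg_dotProduct, smul_dotProduct, sum_dotProduct,
    basisVec_dotProduct, smul_eq_mul]
  ring

theorem h2_dotProduct (D : Station I J T) (j : J) (t : T) (z : Var I J T → ℝ) :
    h2 D j t ⬝ᵥ z = ∑ i, D.s i t * z (.x i j) + z (.psi j t) := by
  simp only [h2, add_dotProduct, smul_dotProduct, sum_dotProduct, basisVec_dotProduct, smul_eq_mul]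

theorem h3_dotProduct (j : J) (t : T) (z : Var I J T → ℝ) :
    h3 j t ⬝ᵥ z = z (.p j t) + z (.zeta j t) := by
  simp only [h3, add_dotProduct, basisVec_dotProduct]

theorem h4_dotProduct (i : I) (z : Var I J T → ℝ) :
    h4 i ⬝ᵥ z = ∑ j, z (.x i j) + z (.xi i) := by
  simp only [h4, add_dotProduct, sum_dotProduct, basisVec_dotProduct]

theorem objVec_dotProduct (D : Station I J T) (z : Var I J T → ℝ) :
    objVec D ⬝ᵥ z = objective D z := by
  simp only [objVec, objective, sub_dotProduct, smul_dotProduct, sum_dotProduct,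
    basisVec_dotProduct, smul_eq_mul, Finset.mul_sum]

theorem linearConstraints_iff (D : Station I J T) (z : Var I J T → ℝ) :
    LinearConstraints D z ↔ (∀ i j, h1 D i j ⬝ᵥ z = 0) ∧ (∀ j t, h2 D j t ⬝ᵥ z = 1) ∧
      (∀ j t, h3 j t ⬝ᵥ z = D.G j t) ∧ ∀ i, h4 i ⬝ᵥ z = 1 := by
  simp only [h1_dotProduct, h2_dotProduct, h3_dotProduct, h4_dotProduct]
  refine ⟨fun h => ⟨fun i j => ?_, fun j t => ?_, fun j t => ?_, fun i => ?_⟩,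
    fun h => ⟨fun i j => ?_, fun j t => ?_, fun j t => ?_, fun i => ?_⟩⟩
  · linarith [h.energy i j]
  · linarith [h.occupancy j t]
  · linarith [h.capacity j t]
  · linarith [h.unique i]
  · linarith [h.1 i j]
  · linarith [h.2.1 j t]
  · linarith [h.2.2.1 j t]
  · linarith [h.2.2.2 i]

/-! ### The bilinear form of the dual slack matrix -/

theorem homog_linMat (h z z' : Var I J T → ℝ) (c c' : ℝ) :
    homog c z ⬝ᵥ (linMat h *ᵥ homog c' z') = 1 / 2 * (c * (h ⬝ᵥ z') + c' * (h ⬝ᵥ z)) := by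
  have e1 : (replicateRow Unit ((1 / 2 : ℝ) • h)) *ᵥ z' = fun _ => 1 / 2 * (h ⬝ᵥ z') := by
    ext
    rw [← smul_eq_mul, ← smul_dotProduct]
    rfl
  have e2 : (replicateCol Unit ((1 / 2 : ℝ) • h)) *ᵥ (fun _ : Unit => c') = (1 / 2 * c') • h := by
    ext; simp [mulVec, dotProduct]; ring
  simp only [homog, linMat, fromBlocks_mulVec, Sum.elim_comp_inl, Sum.elim_comp_inr, e1, e2,
    zero_mulVec, zero_add, add_zero, sumElim_dotProduct_sumElim, dotProduct_smul, smul_eq_mul]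
  rw [dotProduct_comm z h]
  simp [dotProduct]
  ring

/-- Stationarity solved for `Omega` and paired with two vectors. Taking `c = 0` and a basis vector
on the left reads off single rows. -/
theorem COPFeasible.homog_Omega {D : Station I J T} {d : DualVars I J T} (hd : COPFeasible D d)
    (z z' : Var I J T → ℝ) (c c' : ℝ) :
    homog c z ⬝ᵥ (d.Omega *ᵥ homog c' z') =
      ∑ i, ∑ j, (d.lam1 i j * (1 / 2 * (c * (h1 D i j ⬝ᵥ z') + c' * (h1 D i j ⬝ᵥ z)))
        + d.Lam1 i j * ((h1 D i j ⬝ᵥ z) * (h1 D i j ⬝ᵥ z')))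
      + ∑ j, ∑ t, (d.lam2 j t * (1 / 2 * (c * (h2 D j t ⬝ᵥ z') + c' * (h2 D j t ⬝ᵥ z)))
        + d.Lam2 j t * ((h2 D j t ⬝ᵥ z) * (h2 D j t ⬝ᵥ z')))
      + ∑ j, ∑ t, (d.lam3 j t * (1 / 2 * (c * (h3 j t ⬝ᵥ z') + c' * (h3 j t ⬝ᵥ z)))
        + d.Lam3 j t * ((h3 j t ⬝ᵥ z) * (h3 j t ⬝ᵥ z')))
      + ∑ i, (d.lam4 i * (1 / 2 * (c * (h4 i ⬝ᵥ z') + c' * (h4 i ⬝ᵥ z)))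
        + d.Lam4 i * ((h4 i ⬝ᵥ z) * (h4 i ⬝ᵥ z')))
      + ∑ i, ∑ j, d.delta i j *
        (1 / 2 * (c * z' (.x i j) + c' * z (.x i j)) - z (.x i j) * z' (.x i j))
      - 1 / 2 * (c * objective D z' + c' * objective D z) := by
  have h := congrArg (evalForm (homog c z) (homog c' z')) hd.stationarity
  have hl : ∀ v, evalForm (homog c z) (homog c' z') (linMat v)
      = 1 / 2 * (c * (v ⬝ᵥ z') + c' * (v ⬝ᵥ z)) := fun v => homog_linMat v z z' c c'
  have hs : ∀ v, evalForm (homog c z) (homog c' z') (sqMat v) = (v ⬝ᵥ z) * (v ⬝ᵥ z') :=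
    fun v => homog_sqMat v z z' c c'
  have hO : evalForm (homog c z) (homog c' z') d.Omega
      = homog c z ⬝ᵥ (d.Omega *ᵥ homog c' z') := rfl
  simp only [map_add, map_sub, map_sum, map_smul, map_zero, binMat, hl, hs, hO, smul_eq_mul,
    objVec_dotProduct, basisVec_dotProduct] at h
  linarith

/-- The quadratic form of the dual slack matrix at `(1, z)`. -/
theorem COPFeasible.homog_one_Omega {D : Station I J T} {d : DualVars I J T}
    (hd : COPFeasible D d) (z : Var I J T → ℝ) :
    homog 1 z ⬝ᵥ (d.Omega *ᵥ homog 1 z) =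
      ∑ i, ∑ j, (d.lam1 i j * (h1 D i j ⬝ᵥ z) + d.Lam1 i j * (h1 D i j ⬝ᵥ z) ^ 2)
      + ∑ j, ∑ t, (d.lam2 j t * (h2 D j t ⬝ᵥ z) + d.Lam2 j t * (h2 D j t ⬝ᵥ z) ^ 2)
      + ∑ j, ∑ t, (d.lam3 j t * (h3 j t ⬝ᵥ z) + d.Lam3 j t * (h3 j t ⬝ᵥ z) ^ 2)
      + ∑ i, (d.lam4 i * (h4 i ⬝ᵥ z) + d.Lam4 i * (h4 i ⬝ᵥ z) ^ 2)
      + ∑ i, ∑ j, d.delta i j * (z (.x i j) - z (.x i j) ^ 2)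
      - objective D z := by
  rw [hd.homog_Omega]
  congr 1
  · congr 1
    · congr 1
      · congr 1
        · congr 1 <;> exact Finset.sum_congr rfl fun _ _ => Finset.sum_congr rfl fun _ _ => by ring
        · exact Finset.sum_congr rfl fun _ _ => Finset.sum_congr rfl fun _ _ => by ring
      · exact Finset.sum_congr rfl fun _ _ => by ring
    · exact Finset.sum_congr rfl fun _ _ => Finset.sum_congr rfl fun _ _ => by ring
  · ring

/-! ### The completely positive program has the value of the MILP -/

/-- Every summand of a completely positive `[1, zᵀ; z, Z]` satisfies the homogenized form of a
linear constraint that holds for `z` and, squared, for `Z`. -/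
theorem dotProduct_eq_of_bordered {k : ℕ} {w : Fin k → Unit ⊕ Var I J T → ℝ}
    {z : Var I J T → ℝ} {Z : Matrix (Var I J T) (Var I J T) ℝ}
    (hone : ∑ m, w m (.inl ()) ^ 2 = 1)
    (hz : ∀ a, z a = ∑ m, w m (.inl ()) * w m (.inr a))
    (hZ : Z = ∑ m, vecMulVec (w m ∘ Sum.inr) (w m ∘ Sum.inr))
    {h : Var I J T → ℝ} {b : ℝ} (hb : h ⬝ᵥ z = b)
    (hb2 : (vecMulVec h h * Z).trace = b ^ 2) (m : Fin k) :
    h ⬝ᵥ (w m ∘ Sum.inr) = b * w m (.inl ()) := by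
  have hsum : ∑ m, (h ⬝ᵥ (w m ∘ Sum.inr) - b * w m (.inl ())) ^ 2 = 0 := by
    have e1 : ∑ m, (h ⬝ᵥ (w m ∘ Sum.inr)) ^ 2 = b ^ 2 := by
      rw [← hb2, trace_vecMulVec_mul, hZ, sum_mulVec, dotProduct_sum]
      refine Finset.sum_congr rfl fun m _ => ?_
      rw [vecMulVec_mulVec, dotProduct_comm (w m ∘ Sum.inr) h]
      simp [sq]
    have e2 : ∑ m, w m (.inl ()) * (h ⬝ᵥ (w m ∘ Sum.inr)) = b := by
      rw [← hb]
      simp only [dotProduct, hz, Finset.mul_sum, Function.comp]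
      rw [Finset.sum_comm]
      exact Finset.sum_congr rfl fun _ _ => Finset.sum_congr rfl fun _ _ => by ring
    calc ∑ m, (h ⬝ᵥ (w m ∘ Sum.inr) - b * w m (.inl ())) ^ 2
        = ∑ m, ((h ⬝ᵥ (w m ∘ Sum.inr)) ^ 2 - 2 * b * (w m (.inl ()) * (h ⬝ᵥ (w m ∘ Sum.inr)))
            + b ^ 2 * w m (.inl ()) ^ 2) := Finset.sum_congr rfl fun _ _ => by ring
      _ = 0 := by
        rw [Finset.sum_add_distrib, Finset.sum_sub_distrib, ← Finset.mul_sum, ← Finset.mul_sum,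
          e1, e2, hone]
        ring
  have := (Finset.sum_eq_zero_iff_of_nonneg fun m _ => sq_nonneg _).1 hsum m (Finset.mem_univ m)
  exact sub_eq_zero.1 (pow_eq_zero_iff (two_ne_zero) |>.1 this)

theorem CPPFeasible.objective_le {D : Station I J T} {z : Var I J T → ℝ}
    {Z : Matrix (Var I J T) (Var I J T) ℝ} (h : CPPFeasible D z Z) {r : ℝ}
    (hr : ∀ z', MILPFeasible D z' → objective D z' ≤ r) : objective D z ≤ r := by
  obtain ⟨k, w, hw, hX⟩ := h.cone
  have hone : ∑ m, w m (.inl ()) ^ 2 = 1 := by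
    have := congrFun (congrFun hX (.inl ())) (.inl ())
    simpa [bordered, Matrix.sum_apply, vecMulVec_apply, sq] using this.symm
  have hz : ∀ a, z a = ∑ m, w m (.inl ()) * w m (.inr a) := fun a => by
    have := congrFun (congrFun hX (.inl ())) (.inr a)
    simpa [bordered, Matrix.sum_apply, vecMulVec_apply] using this
  have hZ : Z = ∑ m, vecMulVec (w m ∘ Sum.inr) (w m ∘ Sum.inr) := by
    ext a b
    have := congrFun (congrFun hX (.inr a)) (.inr b)
    simpa [bordered, Matrix.sum_apply, vecMulVec_apply] using this
  obtain ⟨l1, l2, l3, l4⟩ := (linearConstraints_iff D z).1 h.linear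
  have c1 := fun i j => dotProduct_eq_of_bordered hone hz hZ (l1 i j) (by rw [h.trace1]; ring)
  have c2 := fun j t => dotProduct_eq_of_bordered hone hz hZ (l2 j t) (by rw [h.trace2]; ring)
  have c3 := fun j t => dotProduct_eq_of_bordered hone hz hZ (l3 j t) (h.trace3 j t)
  have c4 := fun i => dotProduct_eq_of_bordered hone hz hZ (l4 i) (by rw [h.trace4]; ring)
  -- The one-spot constraint supplies the bound `x ≤ 1` in homogenized form; it makes every term of
  -- the sum behind `hbin` nonnegative.
  have hle : ∀ m i j, w m (.inr (.x i j)) ≤ w m (.inl ()) := fun m i j => by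
    have h4 := c4 i m
    rw [h4_dotProduct] at h4
    have := Finset.single_le_sum (f := fun j => w m (.inr (.x i j)))
      (fun j _ => hw m _) (Finset.mem_univ j)
    simp only [Function.comp] at h4
    linarith [hw m (.inr (.xi i))]
  have hbin : ∀ i j m,
      w m (.inr (.x i j)) * (w m (.inl ()) - w m (.inr (.x i j))) = 0 := fun i j m => by
    refine (Finset.sum_eq_zero_iff_of_nonneg fun m _ =>
      mul_nonneg (hw m _) (sub_nonneg.2 (hle m i j))).1 ?_ m (Finset.mem_univ m)
    have hb := h.binary i j
    rw [hz, hZ, Matrix.sum_apply] at hb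
    simp only [vecMulVec_apply, Function.comp] at hb
    rw [← sub_eq_zero, ← Finset.sum_sub_distrib] at hb
    rw [← hb]
    exact Finset.sum_congr rfl fun _ _ => by ring
  have hterm : ∀ m, w m (.inl ()) * objective D (w m ∘ Sum.inr) ≤ w m (.inl ()) ^ 2 * r := by
    intro m
    rcases (hw m (.inl ())).eq_or_lt with h0 | hpos
    -- A summand with zero border cannot be rescaled, but enters `z` with weight zero.
    · simp [← h0]
    set a := w m (.inl ())
    have hfeas : MILPFeasible D (a⁻¹ • (w m ∘ Sum.inr)) := by
      refine ⟨(linearConstraints_iff D _).2 ⟨fun i j => ?_, fun j t => ?_, fun j t => ?_,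
        fun i => ?_⟩, fun i j => ?_, fun b => mul_nonneg (inv_nonneg.2 hpos.le) (hw m _)⟩
      · rw [dotProduct_smul, c1]; simp
      · rw [dotProduct_smul, c2, smul_eq_mul, one_mul, inv_mul_cancel₀ hpos.ne']
      · rw [dotProduct_smul, c3, smul_eq_mul]; rw [mul_left_comm, inv_mul_cancel₀ hpos.ne', mul_one]
      · rw [dotProduct_smul, c4, smul_eq_mul, one_mul, inv_mul_cancel₀ hpos.ne']
      · rcases mul_eq_zero.1 (hbin i j m) with h | h
        · left; simp [h]
        · right
          have : w m (.inr (.x i j)) = a := by linarith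
          simp [this, hpos.ne']
    have := hr _ hfeas
    rw [← objVec_dotProduct, dotProduct_smul, objVec_dotProduct, smul_eq_mul,
      inv_mul_le_iff₀ hpos] at this
    nlinarith
  calc objective D z = ∑ m, w m (.inl ()) * objective D (w m ∘ Sum.inr) := by
        simp only [← objVec_dotProduct, dotProduct, hz, Finset.mul_sum, Function.comp]
        rw [Finset.sum_comm]
        exact Finset.sum_congr rfl fun _ _ => Finset.sum_congr rfl fun _ _ => by ring
    _ ≤ ∑ m, w m (.inl ()) ^ 2 * r := Finset.sum_le_sum fun m _ => hterm m
    _ = r := by rw [← Finset.sum_mul, hone, one_mul]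

/-- A feasible point of the MILP lifts to the completely positive program. -/
theorem MILPFeasible.cppFeasible {D : Station I J T} {z : Var I J T → ℝ}
    (h : MILPFeasible D z) : CPPFeasible D z (vecMulVec z z) := by
  have ht : ∀ v : Var I J T → ℝ, (vecMulVec v v * vecMulVec z z).trace = (v ⬝ᵥ z) ^ 2 := fun v => by
    rw [trace_vecMulVec_mul, vecMulVec_mulVec, dotProduct_comm z v]
    simp [sq]
  obtain ⟨l1, l2, l3, l4⟩ := (linearConstraints_iff D z).1 h.linear
  refine ⟨h.linear, fun i j => ?_, fun j t => ?_, fun j t => ?_, fun i => ?_, fun i j => ?_,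
    1, fun _ => homog 1 z, fun _ => homog_nonneg zero_le_one h.nonneg, ?_⟩
  · simp [ht, l1]
  · simp [ht, l2]
  · simp [ht, l3]
  · simp [ht, l4]
  · rcases h.binary i j with h | h <;> simp [vecMulVec_apply, h]
  · ext (a | a) (b | b) <;> simp [bordered, homog, vecMulVec_apply]

theorem MILPOptimal.isLUB {D : Station I J T} {z : Var I J T → ℝ} (hz : MILPOptimal D z) :
    IsLUB (CPPValues D) (objective D z) :=
  IsGreatest.isLUB ⟨⟨z, _, hz.1.cppFeasible, rfl⟩, by
    rintro _ ⟨z', Z, h, rfl⟩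
    exact h.objective_le hz.2⟩

/-- Strong duality enters the proof only through this equality. -/
theorem StrongDuality.copObjective_eq {D : Station I J T} (h : StrongDuality D)
    {z : Var I J T → ℝ} (hz : MILPOptimal D z) {d : DualVars I J T} (hd : COPOptimal D d) :
    copObjective D d = objective D z := by
  obtain ⟨r, h1, h2⟩ := h
  rw [hz.isLUB.unique h1]
  have hleast : IsLeast (COPValues D) (copObjective D d) := ⟨⟨d, hd.1, rfl⟩, by
    rintro _ ⟨d', h, rfl⟩
    exact hd.2 d' h⟩
  exact hleast.isGLB.unique h2

/-! ### Complementary slackness -/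

/-- At a feasible `z` the form equals the duality gap: the constraint terms add up to `copObjective`
and the binary terms vanish. -/
theorem homog_Omega_eq_zero {D : Station I J T} {z : Var I J T → ℝ} (hz : MILPFeasible D z)
    {d : DualVars I J T} (hd : COPFeasible D d) (hval : copObjective D d = objective D z) :
    homog 1 z ⬝ᵥ (d.Omega *ᵥ homog 1 z) = 0 := by
  obtain ⟨l1, l2, l3, l4⟩ := (linearConstraints_iff D z).1 hz.linear
  have hb : ∀ i j, z (.x i j) - z (.x i j) ^ 2 = 0 := fun i j => by
    rcases hz.binary i j with h | h <;> simp [h]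
  rw [hd.homog_one_Omega, ← hval, copObjective]
  simp only [l1, l2, l3, l4, hb, Finset.sum_add_distrib]
  simp [mul_comm]
  ring

/-- The border of the dual slack matrix is nonnegative, and vanishes on the support of an optimal
`z`; on the support, the first-order condition holds with equality. -/
theorem border_slackness {D : Station I J T} {z : Var I J T → ℝ} (hz : MILPFeasible D z)
    {d : DualVars I J T} (hd : COPFeasible D d) (hval : copObjective D d = objective D z)
    (a : Var I J T) :
    0 ≤ homog 0 (basisVec a) ⬝ᵥ (d.Omega *ᵥ homog 1 0) ∧
    (0 < z a → homog 0 (basisVec a) ⬝ᵥ (d.Omega *ᵥ homog 1 0) = 0 ∧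
      homog 0 (basisVec a) ⬝ᵥ (d.Omega *ᵥ homog 1 z) = 0) := by
  have hbv : ∀ (a : Var I J T) (y : Unit ⊕ Var I J T → ℝ),
      homog 0 (basisVec a) ⬝ᵥ y = y (.inr a) := fun a y => by
    simp [homog, basisVec, dotProduct, Fintype.sum_sum_type, Pi.single_apply]
  have hw := homog_nonneg (zero_le_one (α := ℝ)) hz.nonneg
  have h0 := homog_nonneg (I := I) (J := J) (T := T) (c := 1) (z := 0)
    zero_le_one (fun _ => by simp)
  have hQ := homog_Omega_eq_zero hz hd hval
  have hQ0 : homog 1 0 ⬝ᵥ (d.Omega *ᵥ homog 1 0) = 0 := by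
    rw [hd.homog_one_Omega, ← objVec_dotProduct]
    simp
  have hn := hd.cone.mulVec_nonneg h0 hQ0
  rw [hbv, hbv]
  refine ⟨hn _, fun hpos => ⟨?_, ?_⟩⟩
  -- By symmetry this is the border entry of `Omega (1, z)`, which vanishes by slackness because its
  -- weight is 1.
  · have hz0 : homog 1 z ⬝ᵥ (d.Omega *ᵥ homog 1 0) = 0 := by
      have := hd.cone.mul_mulVec_eq_zero hw hQ (.inl ())
      have e : homog 1 0 ⬝ᵥ (d.Omega *ᵥ homog 1 z) = (d.Omega *ᵥ homog 1 z) (.inl ()) := by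
        simp [homog, dotProduct, Fintype.sum_sum_type]
      rw [dotProduct_mulVec, ← mulVec_transpose, hd.cone.1.eq, dotProduct_comm, e]
      simpa [homog] using this
    have := (Finset.sum_eq_zero_iff_of_nonneg fun b _ => mul_nonneg (hw b) (hn b)).1 hz0
      (.inr a) (Finset.mem_univ _)
    exact (mul_eq_zero.1 this).resolve_left hpos.ne'
  · exact (mul_eq_zero.1 (hd.cone.mul_mulVec_eq_zero hw hQ (.inr a))).resolve_left hpos.ne'

/-! ### Sign conditions on the multipliers -/

/-- The border entry of `Omega` at `φ_ij` is `-lam1 i j / 2`. -/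
theorem lam1_nonpos {D : Station I J T} {z : Var I J T → ℝ} (hz : MILPFeasible D z)
    {d : DualVars I J T} (hd : COPFeasible D d) (hval : copObjective D d = objective D z)
    (i : I) (j : J) : d.lam1 i j ≤ 0 := by
  have h := (border_slackness hz hd hval (.phi i j)).1
  have e1 : ∀ i' j', h1 D i' j' ⬝ᵥ basisVec (.phi i j) =
      if i = i' then (if j = j' then -1 else 0) else 0 := fun i' j' => by
    simp only [h1_dotProduct]
    by_cases hi : i = i' <;> by_cases hj : j = j' <;>
      simp [basisVec, hi, hj, eq_comm (a := i'), eq_comm (a := j')]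
  have e2 : ∀ j' t', h2 D j' t' ⬝ᵥ basisVec (.phi i j) = 0 := by
    intros; rw [h2_dotProduct]; simp [basisVec]
  have e3 : ∀ (j' : J) (t' : T), (h3 j' t' : Var I J T → ℝ) ⬝ᵥ basisVec (.phi i j) = 0 := by
    intros; rw [h3_dotProduct]; simp [basisVec]
  have e4 : ∀ i', (h4 i' : Var I J T → ℝ) ⬝ᵥ basisVec (.phi i j) = 0 := by
    intros; rw [h4_dotProduct]; simp [basisVec]
  rw [hd.homog_Omega] at h
  simp only [e1, e2, e3, e4] at h
  simp [objective, basisVec] at h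
  linarith

/-- On the support both `Omega (1, 0)` and `Omega (1, z)` vanish at `p_j(t)`. Their difference is
`Lam3 * G`, and `G ≥ p > 0`. The first equation gives `cost + lam3 = -∑ lam1 * s`, which is
nonnegative by `lam1_nonpos`. -/
theorem capacity_price {D : Station I J T} {z : Var I J T → ℝ} (hz : MILPFeasible D z)
    {d : DualVars I J T} (hd : COPFeasible D d) (hval : copObjective D d = objective D z)
    {j : J} {t : T} (hp : 0 < z (.p j t)) :
    d.Lam3 j t = 0 ∧ 0 ≤ D.cost t + d.lam3 j t := by
  obtain ⟨-, h⟩ := border_slackness hz hd hval (.p j t)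
  obtain ⟨ha, hb⟩ := h hp
  obtain ⟨l1, l2, l3, l4⟩ := (linearConstraints_iff D z).1 hz.linear
  have e1 : ∀ i' j', h1 D i' j' ⬝ᵥ basisVec (.p j t) =
      if j = j' then D.s i' t else 0 := fun i' j' => by
    simp only [h1_dotProduct]
    by_cases hj : j = j' <;> simp [basisVec, Pi.single_apply, hj, eq_comm (a := j')]
  have e2 : ∀ j' t', h2 D j' t' ⬝ᵥ basisVec (.p j t) = 0 := by
    intros; rw [h2_dotProduct]; simp [basisVec]
  have e3 : ∀ (j' : J) (t' : T), (h3 j' t' : Var I J T → ℝ) ⬝ᵥ basisVec (.p j t) =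
      if j = j' then (if t = t' then 1 else 0) else 0 := fun j' t' => by
    rw [h3_dotProduct]
    by_cases hj : j = j' <;> by_cases ht : t = t' <;>
      simp [basisVec, hj, ht, eq_comm (a := j'), eq_comm (a := t')]
  have e4 : ∀ i', (h4 i' : Var I J T → ℝ) ⬝ᵥ basisVec (.p j t) = 0 := by
    intros; rw [h4_dotProduct]; simp [basisVec]
  have e5 : objective D (basisVec (.p j t)) = -D.cost t := by
    rw [objective, Finset.sum_eq_single_of_mem t (Finset.mem_univ t),
      Finset.sum_eq_single_of_mem j (Finset.mem_univ j)]
    · simp [basisVec]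
    · intro j' _ hj; simp [basisVec, hj]
    · intro t' _ ht; simp [basisVec, ht]
  rw [hd.homog_Omega] at ha hb
  simp only [e1, e2, e3, e4, e5, l1, l2, l3, l4] at ha hb
  simp [basisVec, Finset.sum_add_distrib] at ha hb
  have hG : 0 < D.G j t := by linarith [hz.linear.capacity j t, hz.nonneg (.zeta j t)]
  have hs : ∑ i, d.lam1 i j * (2⁻¹ * D.s i t) ≤ 0 := Finset.sum_nonpos fun i _ =>
    mul_nonpos_of_nonpos_of_nonneg (lam1_nonpos hz hd hval i j) (by
      rcases D.s_binary i t with h | h <;> simp [h])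
  have hL : d.Lam3 j t * D.G j t = 0 := by linarith
  exact ⟨(mul_eq_zero.1 hL).resolve_right hG.ne', by linarith⟩

/-! ### The deviation of a single user -/

/-- The central solution after user `i` has switched to `xi`: the power that user `i` no longer
takes at the spot left behind is not delivered. -/
def deviate (D : Station I J T) (z : Var I J T → ℝ) (i : I) (xi : J → ℝ) : Var I J T → ℝ
  | .x l j => Function.update (assignment z) i xi l j
  | .p j t => (1 - D.s i t * (z (.x i j) * (1 - xi j))) * z (.p j t)
  | .phi l j => ∑ t, D.s l t * ((1 - D.s i t * (z (.x i j) * (1 - xi j))) * z (.p j t))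
      - D.e l * Function.update (assignment z) i xi l j
  | .psi j t => z (.psi j t)
  | .zeta j t => z (.zeta j t)
  | .xi l => 1 - ∑ j, Function.update (assignment z) i xi l j

theorem deviate_nonneg {D : Station I J T} {z : Var I J T → ℝ} (hz : MILPFeasible D z) {i : I}
    {xi phii : J → ℝ} {xii : ℝ} (h : UserFeasible D z i xi phii xii) (a : Var I J T) :
    0 ≤ deviate D z i xi a := by
  have hkeep : ∀ j t, 0 ≤ 1 - D.s i t * (z (.x i j) * (1 - xi j)) := fun j t => by
    rcases D.s_binary i t with hs | hs <;> rcases hz.binary i j with hx | hx <;>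
      rcases h.binary j with hy | hy <;> simp [hs, hx, hy]
  have hs0 : ∀ l t, 0 ≤ D.s l t := fun l t => by
    rcases D.s_binary l t with hs | hs <;> simp [hs]
  have hp : ∀ l j t, 0 ≤ D.s l t * ((1 - D.s i t * (z (.x i j) * (1 - xi j))) * z (.p j t)) :=
    fun l j t => mul_nonneg (hs0 l t) (mul_nonneg (hkeep j t) (hz.nonneg _))
  rcases a with ⟨l, j⟩ | ⟨j, t⟩ | ⟨l, j⟩ | ⟨j, t⟩ | ⟨j, t⟩ | l
  · by_cases hl : l = i
    · subst hl; simpa [deviate] using h.x_nonneg j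
    · simpa [deviate, hl, assignment] using hz.nonneg _
  · exact mul_nonneg (hkeep j t) (hz.nonneg _)
  · by_cases hl : l = i
    · subst hl
      simp only [deviate, Function.update_self]
      rcases h.binary j with hy | hy
      · rw [hy, mul_zero, sub_zero]
        exact Finset.sum_nonneg fun t _ => by simpa [hy] using hp l j t
      · have := h.energy j
        have := h.phi_nonneg j
        simp only [hy, sub_self, mul_zero, sub_zero, one_mul] at *
        linarith
    · simp only [deviate, Function.update_of_ne hl, assignment]
      rcases hz.binary l j with hx | hx
      · rw [hx, mul_zero, sub_zero]
        exact Finset.sum_nonneg fun t _ => hp l j t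
      -- Occupancy keeps `l` and `i` from sharing spot `j` in any period, so the power dropped for
      -- `i` was never needed by `l`.
      · have hdisj : ∀ t, D.s l t * (D.s i t * z (.x i j)) = 0 := fun t => by
          have hle : D.s l t * z (.x l j) + D.s i t * z (.x i j) ≤ 1 := by
            have h2 := Finset.sum_le_sum_of_subset_of_nonneg (Finset.subset_univ {l, i})
              (f := fun k => D.s k t * z (.x k j))
              fun k _ _ => mul_nonneg (hs0 k t) (hz.nonneg _)
            rw [Finset.sum_pair hl] at h2
            linarith [hz.linear.occupancy j t, hz.nonneg (.psi j t)]
          rw [hx] at hle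
          rcases D.s_binary l t with hs | hs
          · simp [hs]
          · have := mul_nonneg (hs0 i t) (hz.nonneg (.x i j))
            rw [hs] at hle ⊢
            linarith
        have := hz.nonneg (.phi l j)
        rw [← hz.linear.energy l j] at this
        refine this.trans_eq ?_
        congr 1
        refine Finset.sum_congr rfl fun t _ => ?_
        linear_combination ((1 - xi j) * z (.p j t)) * hdisj t
  · exact hz.nonneg _
  · exact hz.nonneg _
  · by_cases hl : l = i
    · subst hl
      simp only [deviate, Function.update_self]
      linarith [h.unique, h.xi_nonneg]
    · simp only [deviate, Function.update_of_ne hl, assignment]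
      linarith [hz.linear.unique l, hz.nonneg (.xi l)]

/-- Changing row `i` of a sum changes it by the contribution of that row. -/
theorem sum_update_row (f : I → ℝ → ℝ) (A : I → J → ℝ) (i : I) (xi : J → ℝ) (j : J) :
    ∑ l, f l (Function.update A i xi l j) = ∑ l, f l (A l j) + (f i (xi j) - f i (A i j)) := by
  rw [← Finset.add_sum_erase _ _ (Finset.mem_univ i),
    ← Finset.add_sum_erase Finset.univ (fun l => f l (A l j)) (Finset.mem_univ i),
    Finset.sum_congr rfl fun l hl => by rw [Function.update_of_ne (Finset.ne_of_mem_erase hl)]]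
  rw [Function.update_self]
  ring

theorem objective_deviate (D : Station I J T) (z : Var I J T → ℝ) (i : I) (xi : J → ℝ) :
    objective D (deviate D z i xi) = objective D z + ∑ j, D.v i * (xi j - z (.x i j))
      + ∑ j, ∑ t, D.cost t * (D.s i t * (z (.x i j) * (1 - xi j)) * z (.p j t)) := by
  have e1 : ∑ l, ∑ j, D.v l * deviate D z i xi (.x l j)
      = ∑ l, ∑ j, D.v l * z (.x l j) + ∑ j, D.v i * (xi j - z (.x i j)) := by
    rw [Finset.sum_comm, Finset.sum_comm (f := fun l j => D.v l * z (.x l j)),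
      ← Finset.sum_add_distrib]
    refine Finset.sum_congr rfl fun j _ => ?_
    simp only [deviate]
    rw [sum_update_row (fun l y => D.v l * y)]
    simp only [assignment]
    ring
  have e2 : ∑ t, D.cost t * ∑ j, deviate D z i xi (.p j t) = ∑ t, D.cost t * ∑ j, z (.p j t)
      - ∑ j, ∑ t, D.cost t * (D.s i t * (z (.x i j) * (1 - xi j)) * z (.p j t)) := by
    rw [Finset.sum_comm (f := fun j t => D.cost t * _), ← Finset.sum_sub_distrib]
    refine Finset.sum_congr rfl fun t _ => ?_
    rw [← Finset.mul_sum, ← mul_sub, ← Finset.sum_sub_distrib]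
    congr 1
    refine Finset.sum_congr rfl fun j _ => ?_
    simp only [deviate]
    ring
  rw [objective, e1, e2, objective]
  ring

/-- The copositive inequality at the deviation of user `i`. -/
theorem deviation_gain_le {D : Station I J T} {z : Var I J T → ℝ} (hz : MILPFeasible D z)
    {d : DualVars I J T} (hd : COPFeasible D d) (hval : copObjective D d = objective D z) {i : I}
    {xi phii : J → ℝ} {xii : ℝ} (h : UserFeasible D z i xi phii xii) :
    ∑ j, D.v i * (xi j - z (.x i j))
      + ∑ j, ∑ t, D.cost t * (D.s i t * (z (.x i j) * (1 - xi j)) * z (.p j t)) ≤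
    ∑ j, ∑ t, (d.lam2 j t * (D.s i t * (xi j - z (.x i j)))
        + d.Lam2 j t * ((1 + D.s i t * (xi j - z (.x i j))) ^ 2 - 1))
      + ∑ j, ∑ t, (d.lam3 j t * -(D.s i t * (z (.x i j) * (1 - xi j)) * z (.p j t))
        + d.Lam3 j t *
          ((D.G j t - D.s i t * (z (.x i j) * (1 - xi j)) * z (.p j t)) ^ 2 - D.G j t ^ 2)) := by
  have e1 : ∀ l j, h1 D l j ⬝ᵥ deviate D z i xi = 0 := fun l j => by
    rw [h1_dotProduct]; simp only [deviate]; ring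
  -- With `ψ` frozen, the whole change of occupancy shows up as a violation of this row.
  have e2 : ∀ j t, h2 D j t ⬝ᵥ deviate D z i xi = 1 + D.s i t * (xi j - z (.x i j)) :=
    fun j t => by
    rw [h2_dotProduct]
    simp only [deviate]
    rw [sum_update_row (fun l y => D.s l t * y)]
    simp only [assignment]
    linear_combination -hz.linear.occupancy j t
  have e3 : ∀ j t, h3 j t ⬝ᵥ deviate D z i xi
      = D.G j t - D.s i t * (z (.x i j) * (1 - xi j)) * z (.p j t) := fun j t => by
    rw [h3_dotProduct]
    simp only [deviate]
    linear_combination -hz.linear.capacity j t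
  have e4 : ∀ l, h4 l ⬝ᵥ deviate D z i xi = 1 := fun l => by
    rw [h4_dotProduct]; simp only [deviate]; ring
  have e5 : ∀ l j, deviate D z i xi (.x l j) - deviate D z i xi (.x l j) ^ 2 = 0 := fun l j => by
    by_cases hl : l = i
    · subst hl
      rcases h.binary j with hy | hy <;> simp [deviate, hy]
    · rcases hz.binary l j with hx | hx <;> simp [deviate, hl, assignment, hx]
  have hQ := hd.cone.2 _ (homog_nonneg zero_le_one (deviate_nonneg hz h))
  rw [hd.homog_one_Omega, objective_deviate, ← hval, copObjective] at hQ
  simp only [e1, e2, e3, e4, e5] at hQ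
  simp only [mul_add, mul_sub, Finset.sum_add_distrib, Finset.sum_sub_distrib, mul_one,
    mul_zero, Finset.sum_const_zero, mul_neg, Finset.sum_neg_distrib, one_pow, ne_eq,
    OfNat.ofNat_ne_zero, not_false_eq_true, zero_pow, add_zero, mul_comm (d.lam3 _ _) (D.G _ _),
    mul_comm (d.Lam3 _ _) (D.G _ _ ^ 2)] at hQ ⊢
  linarith

/-! ### Welfare of a single user -/

theorem deviationWelfare_eq {D : Station I J T} {z : Var I J T → ℝ} (hz : LinearConstraints D z)
    (d : DualVars I J T) (i : I) (xi : J → ℝ) :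
    deviationWelfare D z d i xi = ∑ j, D.v i * xi j
      - ∑ j, ∑ t, (D.cost t * z (.p j t) + (d.lam3 j t + D.G j t * d.Lam3 j t) * z (.p j t)
        + (d.lam2 j t + d.Lam2 j t * (3 - 2 * (D.s i t * z (.x i j))))) * D.s i t * xi j := by
  -- The occupancy equation at the central `z` eliminates the other users and `ψ`.
  have hc : ∀ j t, 1 + 2 * ∑ l ∈ Finset.univ.erase i,
      D.s l t * Function.update (assignment z) i xi l j + 2 * z (.psi j t)
      = 3 - 2 * (D.s i t * z (.x i j)) := fun j t => by
    rw [Finset.sum_congr rfl fun l hl => by rw [Function.update_of_ne (Finset.ne_of_mem_erase hl)]]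
    have := Finset.add_sum_erase Finset.univ (fun l => D.s l t * z (.x l j)) (Finset.mem_univ i)
    simp only [assignment]
    linarith [hz.occupancy j t]
  simp only [deviationWelfare, welfare, payment, paymentEnergy, paymentCapacity,
    paymentCongestion, Function.update_self, hc, ← Finset.sum_add_distrib]
  congr 1
  exact Finset.sum_congr rfl fun _ _ => Finset.sum_congr rfl fun _ _ => by ring

theorem deviationWelfare_self (D : Station I J T) (z : Var I J T → ℝ) (d : DualVars I J T)
    (i : I) : deviationWelfare D z d i (fun j => z (.x i j)) = welfare D z d i (assignment z) := by
  rw [deviationWelfare]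
  congr 1
  exact Function.update_eq_self i (assignment z)

/-- The bound of `deviation_gain_le` is compared with the change of payment for each spot and
period. Leaving gives equality; joining has slack `(cost + lam3) * p ≥ 0`, the charge for power
already scheduled there. -/
theorem deviationWelfare_le {D : Station I J T} {z : Var I J T → ℝ} (hz : MILPFeasible D z)
    {d : DualVars I J T} (hd : COPFeasible D d) (hval : copObjective D d = objective D z) {i : I}
    {xi phii : J → ℝ} {xii : ℝ} (h : UserFeasible D z i xi phii xii) :
    deviationWelfare D z d i xi ≤ deviationWelfare D z d i (fun j => z (.x i j)) := by
  have hgain := deviation_gain_le hz hd hval h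
  rw [deviationWelfare_eq hz.linear, deviationWelfare_eq hz.linear]
  have hpt : ∀ j t,
      (d.lam2 j t * (D.s i t * (xi j - z (.x i j)))
        + d.Lam2 j t * ((1 + D.s i t * (xi j - z (.x i j))) ^ 2 - 1))
      + (d.lam3 j t * -(D.s i t * (z (.x i j) * (1 - xi j)) * z (.p j t))
        + d.Lam3 j t *
          ((D.G j t - D.s i t * (z (.x i j) * (1 - xi j)) * z (.p j t)) ^ 2 - D.G j t ^ 2))
      - D.cost t * (D.s i t * (z (.x i j) * (1 - xi j)) * z (.p j t)) ≤
      (D.cost t * z (.p j t) + (d.lam3 j t + D.G j t * d.Lam3 j t) * z (.p j t)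
        + (d.lam2 j t + d.Lam2 j t * (3 - 2 * (D.s i t * z (.x i j))))) * D.s i t * xi j
      - (D.cost t * z (.p j t) + (d.lam3 j t + D.G j t * d.Lam3 j t) * z (.p j t)
        + (d.lam2 j t + d.Lam2 j t * (3 - 2 * (D.s i t * z (.x i j))))) * D.s i t
          * z (.x i j) := fun j t => by
    -- Multiplying by the power makes the price conditions hold off the support too.
    have hprice : d.Lam3 j t * z (.p j t) = 0 ∧ 0 ≤ (D.cost t + d.lam3 j t) * z (.p j t) := by
      rcases (hz.nonneg (.p j t)).eq_or_lt with h0 | hpos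
      · simp [← h0]
      · obtain ⟨ha, hb⟩ := capacity_price hz hd hval hpos
        exact ⟨by rw [ha, zero_mul], mul_nonneg hb hpos.le⟩
    obtain ⟨ha, hb⟩ := hprice
    have ha' : d.Lam3 j t * (D.G j t * z (.p j t)) = 0 := by linear_combination D.G j t * ha
    have ha'' : d.Lam3 j t * z (.p j t) ^ 2 = 0 := by linear_combination z (.p j t) * ha
    rcases D.s_binary i t with hs | hs <;> rcases hz.binary i j with hx | hx <;>
      rcases h.binary j with hy | hy <;> rw [hs, hx, hy] <;> linarith
  have hsum : ∀ a b c u v : J → T → ℝ, (∀ j t, a j t + b j t - c j t ≤ u j t - v j t) →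
      ∑ j, ∑ t, a j t + ∑ j, ∑ t, b j t - ∑ j, ∑ t, c j t ≤
        ∑ j, ∑ t, u j t - ∑ j, ∑ t, v j t := fun a b c u v hle => by
    simp only [← Finset.sum_add_distrib, ← Finset.sum_sub_distrib]
    exact Finset.sum_le_sum fun j _ => Finset.sum_le_sum fun t _ => hle j t
  have hv : ∑ j, D.v i * (xi j - z (.x i j)) = ∑ j, D.v i * xi j - ∑ j, D.v i * z (.x i j) := by
    rw [← Finset.sum_sub_distrib]
    exact Finset.sum_congr rfl fun _ _ => by ring
  linarith [hsum _ _ _ _ _ hpt]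

/-- The central assignment is feasible for every user. -/
theorem MILPFeasible.userFeasible {D : Station I J T} {z : Var I J T → ℝ}
    (hz : MILPFeasible D z) (i : I) :
    UserFeasible D z i (fun j => z (.x i j)) (fun j => z (.phi i j)) (z (.xi i)) :=
  ⟨hz.linear.energy i, hz.linear.unique i, hz.binary i, fun _ => hz.nonneg _,
    fun _ => hz.nonneg _, hz.nonneg _⟩

/-- Not charging is an option of every user. -/
theorem MILPFeasible.userFeasible_zero {D : Station I J T} {z : Var I J T → ℝ}
    (hz : MILPFeasible D z) (i : I) :
    UserFeasible D z i 0 (fun j => ∑ t, D.s i t * z (.p j t)) 1 :=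
  ⟨fun _ => by simp, by simp, fun _ => .inl rfl, fun _ => le_rfl,
    fun _ => Finset.sum_nonneg fun t _ => mul_nonneg
      (by rcases D.s_binary i t with h | h <;> simp [h]) (hz.nonneg _), zero_le_one⟩

end

end EVCharging

theorem theorem2 {I J T : Type*} [Fintype I] [Fintype J] [Fintype T]
    [DecidableEq I] [DecidableEq J] [DecidableEq T]
    (D : EVCharging.Station I J T)
    (hdual : EVCharging.StrongDuality D)
    (z : EVCharging.Var I J T → ℝ) (hz : EVCharging.MILPOptimal D z)
    (d : EVCharging.DualVars I J T) (hd : EVCharging.COPOptimal D d) :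
    (∀ i, 0 ≤ EVCharging.welfare D z d i (EVCharging.assignment z)) ∧
    (∀ i, EVCharging.UserOptimal D z d i
      (fun j => z (.x i j)) (fun j => z (.phi i j)) (z (.xi i))) ∧
    EVCharging.IsNashEquilibrium (EVCharging.userOptions D z)
      (EVCharging.welfare D z d) (EVCharging.assignment z) := by
  have hval := hdual.copObjective_eq hz hd
  refine ⟨fun i => ?_, fun i => ⟨hz.1.userFeasible i, fun _ _ _ h =>
    EVCharging.deviationWelfare_le hz.1 hd.1 hval h⟩, fun i => ⟨⟨_, _, hz.1.userFeasible i⟩, ?_⟩⟩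
  · have h := EVCharging.deviationWelfare_le hz.1 hd.1 hval (hz.1.userFeasible_zero i)
    rw [EVCharging.deviationWelfare_self, EVCharging.deviationWelfare_eq hz.1.linear] at h
    simpa using h
  · rintro y ⟨_, _, h⟩
    rw [← EVCharging.deviationWelfare_self]
    exact EVCharging.deviationWelfare_le hz.1 hd.1 hval h
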